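/- A relation $R \subseteq \mathbb{Q}^n$ is called temporal if it has a first-order definition (without parameters) in $(\mathbb{Q};<)$. Let $$T_3 = \{(x,y,z)\in\mathbb{Q}^3 \mid (x=y<z) \vee (x=z<y)\},$$ and let $\mathrm{pp}\colon \mathbb{Q}^2\to\mathbb{Q}$ be an arbitrary operation such that, for all $a,b,a',b'\in\mathbb{Q}$, $\mathrm{pp}(a,b)\le \mathrm{pp}(a',b')$ holds if and only if either $a\le 0$ and $a\le a'$, or $0<a$, $0<a'$ and $b\le b'$. Then a temporal relation $R$ has a primitive positive definition in $(\mathbb{Q};T_3)$ if and only if $R$ is preserved by $\mathrm{pp}$. Here a primitive positive formula is a formula $\exists x_k,\dots,x_\ell.\,\phi$ (possibly with no quantifiers) where $\phi$ is a conjunction of atomic formulas, i.e. of formulas $x=y$, $\bot$, or $T_3(x,y,z)$ with variables $x,y,z$; such a formula with free variables $x_1,\dots,x_n$ is a definition of $R$ if $R$ is the set of all tuples in $\mathbb{Q}^n$ that satisfy it. The operation $\mathrm{pp}$ preserves $R$ if for all $s,t\in R$ the tuple $(\mathrm{pp}(s_1,t_1),\dots,\mathrm{pp}(s_n,t_n))$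 belongs to $R$. -/

import Mathlib

open FirstOrder

namespace Temporal

section Logic

variable {L : Language} {α : Type*}

/-- Conjunctions of atomic formulas. As usual for relational signatures, the atomic formulas are
`x = y`, `⊥` and `R(x₁, …, xₖ)`; the empty conjunction is `⊤`. -/
inductive IsConjOfAtomic : {m : ℕ} → L.BoundedFormula α m → Prop
  | atomic {m : ℕ} {φ : L.BoundedFormula α m} (h : φ.IsAtomic) : IsConjOfAtomic φ
  | bot {m : ℕ} : IsConjOfAtomic (⊥ : L.BoundedFormula α m)
  | top {m : ℕ} : IsConjOfAtomic (⊤ : L.BoundedFormula α m)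
  | inf {m : ℕ} {φ ψ : L.BoundedFormula α m} (hφ : IsConjOfAtomic φ) (hψ : IsConjOfAtomic ψ) :
      IsConjOfAtomic (φ ⊓ ψ)

/-- Primitive positive formulas: a (possibly empty) block of existential quantifiers in front of
a conjunction of atomic formulas. -/
inductive IsPrimitivePositive : {m : ℕ} → L.BoundedFormula α m → Prop
  | conj {m : ℕ} {φ : L.BoundedFormula α m} (h : IsConjOfAtomic φ) : IsPrimitivePositive φ
  | ex {m : ℕ} {φ : L.BoundedFormula α (m + 1)} (h : IsPrimitivePositive φ) :
      IsPrimitivePositive φ.ex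

/-- The `n`-ary relation `R` on the domain `A` of an `L`-structure is primitively positively
definable: it is the relation defined by some primitive positive formula (without parameters)
in the free variables indexed by `Fin n`. -/
def PPDefinable (L : Language) {A : Type*} [L.Structure A] {n : ℕ} (R : Set (Fin n → A)) : Prop :=
  ∃ φ : L.Formula (Fin n), IsPrimitivePositive φ ∧ R = {t | φ.Realize t}

end Logic

/-- An `m`-ary operation `f` on `A` preserves an `n`-ary relation `R` on `A` if applying `f`
componentwise to tuples `t₁, …, tₘ ∈ R` always yields a tuple in `R`. -/
def Preserves {A : Type*} {m n : ℕ} (f : (Fin m → A) → A) (R : Set (Fin n → A)) : Prop :=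
  ∀ t : Fin m → (Fin n → A), (∀ i, t i ∈ R) → (fun j => f (fun i => t i j)) ∈ R

/-- The signature with a single binary relation symbol `<`. -/
inductive LtRel : ℕ → Type
  | lt : LtRel 2

/-- The relational language whose only symbol is `<`. -/
def ltLang : Language := ⟨fun _ => Empty, LtRel⟩

/-- The structure `(ℚ; <)`. -/
instance ltStructure : ltLang.Structure ℚ where
  funMap := fun f => Empty.elim f
  RelMap := fun r => match r with
    | LtRel.lt => fun x => x 0 < x 1

/-- A relation on `ℚ` is temporal if it has a first-order definition (without parameters)
in `(ℚ; <)`. -/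
def IsTemporal {n : ℕ} (R : Set (Fin n → ℚ)) : Prop :=
  (∅ : Set ℚ).Definable ltLang R

/-- The relation `T₃ = {(x, y, z) | x = y < z ∨ x = z < y}` on `ℚ`. -/
def T3 : Set (Fin 3 → ℚ) :=
  {t | (t 0 = t 1 ∧ t 1 < t 2) ∨ (t 0 = t 2 ∧ t 2 < t 1)}

/-- The signature with a single ternary relation symbol. -/
inductive T3Rel : ℕ → Type
  | t3 : T3Rel 3

/-- The relational language whose only symbol is ternary. -/
def t3Lang : Language := ⟨fun _ => Empty, T3Rel⟩

/-- The structure `(ℚ; T₃)`. -/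
instance t3Structure : t3Lang.Structure ℚ where
  funMap := fun f => Empty.elim f
  RelMap := fun r => match r with
    | T3Rel.t3 => fun x => x ∈ T3

/-- The binary operation `f` on `ℚ` is a `pp` operation: it induces on `ℚ²` the weak linear order
in which `(a, b)` is below `(a', b')` if and only if `a ≤ 0` and `a ≤ a'`, or `0 < a`, `0 < a'`
and `b ≤ b'`. -/
def IsPP (f : (Fin 2 → ℚ) → ℚ) : Prop :=
  ∀ a b a' b' : ℚ, f ![a, b] ≤ f ![a', b'] ↔ (a ≤ 0 ∧ a ≤ a') ∨ (0 < a ∧ 0 < a' ∧ b ≤ b')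

end Temporal

namespace Temporal

open FirstOrder.Language

/-! ### Primitive positive definable relations are preserved by `pp` operations -/

/-! A `pp` operation preserves `T3` by a case check, and operations preserving `T3` preserve
whatever is primitive positive over it. Conversely, a temporal `R` is a union of order types of
tuples. If `t ∉ R`, gluing tuples of `R` with `pp` one level set of `t` at a time, from the top,
would yield a tuple ordered like `t` unless some level fails. A failing level gives a `clause` that
holds on `R` and fails at `t` (`IsPP.exists_clause`). So a nonempty `R` is a finite intersection of
clauses, each of which `T3` can express (`T3Definable.clause`). -/

theorem IsPP.lt_iff {f : (Fin 2 → ℚ) → ℚ} (hf : IsPP f) (a b a' b' : ℚ) :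
    f ![a, b] < f ![a', b'] ↔ (a ≤ 0 ∧ a < a') ∨ (0 < a ∧ 0 < a' ∧ b < b') := by
  rw [← not_le, hf]
  grind

theorem IsPP.eq_iff {f : (Fin 2 → ℚ) → ℚ} (hf : IsPP f) (a b a' b' : ℚ) :
    f ![a, b] = f ![a', b'] ↔ (a ≤ 0 ∧ a = a') ∨ (0 < a ∧ 0 < a' ∧ b = b') := by
  rw [le_antisymm_iff, hf, hf]
  grind

theorem IsPP.preserves_T3 {f : (Fin 2 → ℚ) → ℚ} (hf : IsPP f) : Preserves f T3 := by
  intro t ht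
  have h0 := ht 0
  have h1 := ht 1
  have e (j : Fin 3) : (fun i => t i j) = ![t 0 j, t 1 j] := by
    ext i; fin_cases i <;> rfl
  simp only [T3, Set.mem_ofPred_eq, e, hf.lt_iff, hf.eq_iff] at h0 h1 ⊢
  grind

theorem t3Lang_realize_term {β : Type*} {k : ℕ} (f : (Fin k → ℚ) → ℚ) (v : Fin k → β → ℚ)
    (s : t3Lang.Term β) :
    s.realize (fun j => f fun i => v i j) = f fun i => s.realize (v i) := by
  cases s with
  | var x => rfl
  | func g _ => exact Empty.elim g

theorem t3Lang_realize_term_elim {α : Type*} {k m : ℕ} (f : (Fin k → ℚ) → ℚ)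
    (v : Fin k → α → ℚ) (xs : Fin k → Fin m → ℚ) (s : t3Lang.Term (α ⊕ Fin m)) :
    s.realize (Sum.elim (fun j => f fun i => v i j) (fun j => f fun i => xs i j)) =
      f fun i => s.realize (Sum.elim (v i) (xs i)) := by
  rw [← t3Lang_realize_term f (fun i => Sum.elim (v i) (xs i))]
  congr 1
  ext j
  cases j <;> rfl

theorem IsConjOfAtomic.realize_of_preserves {α : Type*} {k m : ℕ} {f : (Fin k → ℚ) → ℚ}
    (hk : k ≠ 0) (hf : Preserves f T3) {φ : t3Lang.BoundedFormula α m} (hφ : IsConjOfAtomic φ) :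
    ∀ (v : Fin k → α → ℚ) (xs : Fin k → Fin m → ℚ), (∀ i, φ.Realize (v i) (xs i)) →
      φ.Realize (fun j => f fun i => v i j) (fun j => f fun i => xs i j) := by
  induction hφ with
  | atomic h =>
    intro v xs hr
    cases h with
    | equal t₁ t₂ =>
      simp only [BoundedFormula.realize_bdEqual] at hr ⊢
      rw [t3Lang_realize_term_elim, t3Lang_realize_term_elim]
      simp only [hr]
    | rel R ts =>
      cases R
      have := hf (fun i j => (ts j).realize (Sum.elim (v i) (xs i))) hr
      simp only [← t3Lang_realize_term_elim] at this
      exact this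
  | bot =>
    intro v xs hr
    -- Positive arity matters only here: for `k = 0` the hypothesis `hr` is vacuous.
    exact (hr ⟨0, Nat.pos_of_ne_zero hk⟩).elim
  | top =>
    intro v xs _
    exact BoundedFormula.realize_top.2 trivial
  | inf _ _ ih₁ ih₂ =>
    intro v xs hr
    simp only [BoundedFormula.realize_inf] at hr ⊢
    exact ⟨ih₁ v xs fun i => (hr i).1, ih₂ v xs fun i => (hr i).2⟩

theorem IsPrimitivePositive.realize_of_preserves {α : Type*} {k m : ℕ} {f : (Fin k → ℚ) → ℚ}
    (hk : k ≠ 0) (hf : Preserves f T3) {φ : t3Lang.BoundedFormula α m}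
    (hφ : IsPrimitivePositive φ) :
    ∀ (v : Fin k → α → ℚ) (xs : Fin k → Fin m → ℚ), (∀ i, φ.Realize (v i) (xs i)) →
      φ.Realize (fun j => f fun i => v i j) (fun j => f fun i => xs i j) := by
  induction hφ with
  | conj h => exact h.realize_of_preserves hk hf
  | ex _ ih =>
    intro v xs hr
    simp only [BoundedFormula.realize_ex] at hr ⊢
    choose a ha using hr
    refine ⟨f a, ?_⟩
    convert ih v (fun i => Fin.snoc (xs i) (a i)) ha using 1
    ext j
    refine Fin.lastCases ?_ (fun j => ?_) j <;> simp

theorem PPDefinable.preserves {k n : ℕ} {f : (Fin k → ℚ) → ℚ} (hk : k ≠ 0) (hf : Preserves f T3)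
    {R : Set (Fin n → ℚ)} (hR : PPDefinable t3Lang R) : Preserves f R := by
  obtain ⟨φ, hφ, rfl⟩ := hR
  intro t ht
  have := hφ.realize_of_preserves hk hf t (fun _ => default) fun i => by
    have := ht i
    rw [Set.mem_ofPred_eq, Formula.Realize] at this
    convert this using 1
  rw [Set.mem_ofPred_eq, Formula.Realize]
  convert this using 1

/-! ### Temporal relations only depend on the order type -/

/-- Two tuples of rationals have the same order type. -/
def SameOrder {ι : Type*} (s t : ι → ℚ) : Prop :=
  ∀ i j, s i < s j ↔ t i < t j

theorem SameOrder.eq_iff {ι : Type*} {s t : ι → ℚ} (h : SameOrder s t) (i j : ι) :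
    s i = s j ↔ t i = t j := by
  have h₁ := h i j
  have h₂ := h j i
  grind

theorem SameOrder.symm {ι : Type*} {s t : ι → ℚ} (h : SameOrder s t) : SameOrder t s :=
  fun i j => (h i j).symm

/-- The back-and-forth step: density and the absence of endpoints let `b` fill the cut of `t`
matching the cut of `a` in `s`. It drives the quantifier case of `SameOrder.realize_iff`. -/
theorem SameOrder.exists_extend {ι : Type*} [Finite ι] {s t : ι → ℚ} (h : SameOrder s t) (a : ℚ) :
    ∃ b : ℚ, ∀ i, (s i < a ↔ t i < b) ∧ (a < s i ↔ b < t i) := by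
  classical
  have := Fintype.ofFinite ι
  by_cases ha : ∃ i, s i = a
  · obtain ⟨i, rfl⟩ := ha
    exact ⟨t i, fun j => ⟨h j i, h i j⟩⟩
  · push Not at ha
    obtain ⟨b, hb₁, hb₂⟩ := Order.exists_between_finsets
      (lo := (Finset.univ.filter fun i => s i < a).image t)
      (hi := (Finset.univ.filter fun i => a < s i).image t) (by
        simp only [Finset.mem_image, Finset.mem_filter, Finset.mem_univ, true_and]
        rintro _ ⟨i, hi, rfl⟩ _ ⟨j, hj, rfl⟩
        exact (h i j).1 (hi.trans hj))
    simp only [Finset.mem_image, Finset.mem_filter, Finset.mem_univ, true_and,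
      forall_exists_index, and_imp, forall_apply_eq_imp_iff₂] at hb₁ hb₂
    refine ⟨b, fun i => ?_⟩
    rcases lt_or_gt_of_ne (ha i) with hi | hi
    · have := hb₁ i hi
      grind
    · have := hb₂ i hi
      grind

theorem SameOrder.realize_iff {α : Type*} [Finite α] {m : ℕ} (φ : ltLang.BoundedFormula α m) :
    ∀ (v v' : α → ℚ) (xs xs' : Fin m → ℚ), SameOrder (Sum.elim v xs) (Sum.elim v' xs') →
      (φ.Realize v xs ↔ φ.Realize v' xs') := by
  induction φ with
  | falsum => exact fun _ _ _ _ _ => Iff.rfl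
  | equal t₁ t₂ =>
    intro v v' xs xs' h
    cases t₁ with
    | func g _ => exact Empty.elim g
    | var x =>
      cases t₂ with
      | func g _ => exact Empty.elim g
      | var y => exact h.eq_iff x y
  | rel R ts =>
    intro v v' xs xs' h
    cases R
    change (ts 0).realize _ < (ts 1).realize _ ↔ (ts 0).realize _ < (ts 1).realize _
    cases ts 0 with
    | func g _ => exact Empty.elim g
    | var x =>
      cases ts 1 with
      | func g _ => exact Empty.elim g
      | var y => exact h x y
  | imp _ _ ih₁ ih₂ =>
    intro v v' xs xs' h
    rw [BoundedFormula.realize_imp, BoundedFormula.realize_imp, ih₁ _ _ _ _ h, ih₂ _ _ _ _ h]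
  | all φ ih =>
    have key : ∀ (v v' : α → ℚ) (xs xs' : Fin _ → ℚ),
        SameOrder (Sum.elim v xs) (Sum.elim v' xs') →
        φ.all.Realize v xs → φ.all.Realize v' xs' := by
      intro v v' xs xs' h hr
      simp only [BoundedFormula.realize_all] at hr ⊢
      intro a
      obtain ⟨b, hb⟩ := h.symm.exists_extend a
      refine (ih _ _ _ _ ?_).1 (hr b)
      have hv (i : α) := hb (Sum.inl i)
      have hx (i : Fin _) := hb (Sum.inr i)
      simp only [Sum.elim_inl, Sum.elim_inr] at hv hx
      rintro (i | i) (j | j)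
      · exact h (Sum.inl i) (Sum.inl j)
      · refine Fin.lastCases ?_ (fun j => ?_) j
        · simp [(hv i).1]
        · simpa using h (Sum.inl i) (Sum.inr j)
      · refine Fin.lastCases ?_ (fun i => ?_) i
        · simp [(hv j).2]
        · simpa using h (Sum.inr i) (Sum.inl j)
      · refine Fin.lastCases ?_ (fun i => ?_) i
        · refine Fin.lastCases ?_ (fun j => ?_) j
          · simp
          · simp [(hx j).2]
        · refine Fin.lastCases ?_ (fun j => ?_) j
          · simp [(hx i).1]
          · simpa using h (Sum.inr i) (Sum.inr j)
    exact fun v v' xs xs' h => ⟨key _ _ _ _ h, key _ _ _ _ h.symm⟩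

theorem IsTemporal.mem_iff {n : ℕ} {R : Set (Fin n → ℚ)} (hR : IsTemporal R) {s t : Fin n → ℚ}
    (h : SameOrder s t) : s ∈ R ↔ t ∈ R := by
  obtain ⟨φ, rfl⟩ := Set.empty_definable_iff.1 hR
  simp only [Set.mem_ofPred_eq]
  refine SameOrder.realize_iff φ _ _ _ _ ?_
  rintro (i | i) (j | j)
  · exact h i j
  · exact j.elim0
  · exact i.elim0
  · exact i.elim0

/-! ### Gluing tuples with a `pp` operation -/

/-- Induction on the up-set `U`: `s` is already right strictly above the lowest level, and `r`
separates that level from those above. In `pp(r - r i, s)` the lowest level has first argument `0`,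
so it is collapsed to one value below the rest; above it the first argument is positive, so `s`
decides. -/
theorem IsPP.exists_sameOrder_on {f : (Fin 2 → ℚ) → ℚ} (hf : IsPP f) {n : ℕ}
    {R : Set (Fin n → ℚ)} (hR : ∀ s t : Fin n → ℚ, SameOrder s t → s ∈ R → t ∈ R)
    (hfR : Preserves f R) (hne : R.Nonempty) {t : Fin n → ℚ}
    (ht : ∀ i, ∃ r ∈ R, (∀ j, t j = t i → r j = r i) ∧ ∀ j, t i < t j → r i < r j)
    (U : Finset (Fin n)) (hU : ∀ j ∈ U, ∀ k, t j ≤ t k → k ∈ U) :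
    ∃ s ∈ R, ∀ j ∈ U, ∀ k ∈ U, s j < s k ↔ t j < t k := by
  induction U using Finset.strongInduction with
  | H U ih =>
    rcases U.eq_empty_or_nonempty with rfl | hUne
    · obtain ⟨s, hs⟩ := hne
      exact ⟨s, hs, by simp⟩
    · obtain ⟨i, hi, hmin⟩ := U.exists_min_image t hUne
      obtain ⟨s, hs, hst⟩ := ih (U.filter fun j => t i < t j)
        (Finset.filter_ssubset.2 ⟨i, hi, lt_irrefl _⟩) (by
          intro j hj k hk
          rw [Finset.mem_filter] at hj ⊢
          exact ⟨hU j hj.1 k hk, hj.2.trans_le hk⟩)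
      obtain ⟨r, hr, hr₁, hr₂⟩ := ht i
      -- The translation puts the level of `i` at `0`, the threshold of `pp`.
      have hr' : (fun j => r j - r i) ∈ R := hR r _ (fun j k => by simp) hr
      refine ⟨_, hfR ![fun j => r j - r i, s] (by simp [Fin.forall_fin_two, hr', hs]), ?_⟩
      have e (j : Fin n) : (fun l => (![fun j => r j - r i, s] : Fin 2 → Fin n → ℚ) l j) =
          ![r j - r i, s j] := by
        ext l; fin_cases l <;> rfl
      intro j hj k hk
      simp only [e, hf.lt_iff]
      simp only [Finset.mem_filter, and_imp] at hst
      have hj₁ := hr₁ j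
      have hk₁ := hr₁ k
      have hj₂ := hr₂ j
      have hk₂ := hr₂ k
      have hjk := hst j hj
      rcases (hmin j hj).eq_or_lt with h | h <;> rcases (hmin k hk).eq_or_lt with h' | h'
      · grind
      · grind
      · grind
      · have := hst j hj h k hk h'
        grind

/-- The clause `⋁ x ∈ X, t x ≠ t y ∨ ⋁ z ∈ Z, t z ≤ t y`. -/
def clause {α : Type*} (y : α) (X Z : Finset α) : Set (α → ℚ) :=
  {t | (∃ x ∈ X, t x ≠ t y) ∨ ∃ z ∈ Z, t z ≤ t y}

theorem IsPP.exists_clause {f : (Fin 2 → ℚ) → ℚ} (hf : IsPP f) {n : ℕ}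
    {R : Set (Fin n → ℚ)} (hR : ∀ s t : Fin n → ℚ, SameOrder s t → s ∈ R → t ∈ R)
    (hfR : Preserves f R) (hne : R.Nonempty) {t : Fin n → ℚ} (ht : t ∉ R) :
    ∃ y X Z, y ∈ X ∧ R ⊆ clause y X Z ∧ t ∉ clause y X Z := by
  by_contra! hcon
  have key (i : Fin n) :
      ∃ r ∈ R, (∀ j, t j = t i → r j = r i) ∧ ∀ j, t i < t j → r i < r j := by
    by_contra! h
    -- Take for `X` the level of `i` and for `Z` everything above: a tuple of `R` violating this
    -- clause is the required `r`.
    refine absurd (hcon i (Finset.univ.filter fun j => t j = t i)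
      (Finset.univ.filter fun j => t i < t j) (by simp) ?_) (by simp [clause])
    intro r hr
    simp only [clause, Finset.mem_filter, Finset.mem_univ, true_and, Set.mem_ofPred_eq]
    by_contra! hr'
    obtain ⟨j, hj, hj'⟩ := h r hr hr'.1
    exact (hr'.2 j hj).not_ge hj'
  obtain ⟨s, hs, hst⟩ := hf.exists_sameOrder_on hR hfR hne key Finset.univ (by simp)
  exact ht (hR s t (fun j k => hst j (Finset.mem_univ _) k (Finset.mem_univ _)) hs)

/-! ### Relations defined by `T₃` constraints -/

/-- The relation is the projection of the solution set of a finite system of `T₃` constraints. -/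
def T3Definable {α : Type} (S : Set (α → ℚ)) : Prop :=
  ∃ (β : Type) (_ : Finite β) (C : List (Fin 3 → α ⊕ β)),
    ∀ t, t ∈ S ↔ ∃ w : β → ℚ, ∀ c ∈ C, Sum.elim t w ∘ c ∈ T3

namespace T3Definable

variable {α : Type}

theorem univ : T3Definable (Set.univ : Set (α → ℚ)) :=
  ⟨Empty, inferInstance, [], by simp⟩

theorem t3 (c : Fin 3 → α) : T3Definable {t : α → ℚ | t ∘ c ∈ T3} :=
  ⟨Empty, inferInstance, [Sum.inl ∘ c], by simp [← Function.comp_assoc]⟩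

theorem inter {S T : Set (α → ℚ)} (hS : T3Definable S) (hT : T3Definable T) :
    T3Definable (S ∩ T) := by
  obtain ⟨β, _, C, hC⟩ := hS
  obtain ⟨γ, _, D, hD⟩ := hT
  refine ⟨β ⊕ γ, inferInstance, C.map (Sum.map id Sum.inl ∘ ·) ++ D.map (Sum.map id Sum.inr ∘ ·),
    fun t => ?_⟩
  have e (u : β → ℚ) (w : γ → ℚ) : Sum.elim t (Sum.elim u w) ∘ Sum.map id Sum.inl =
      Sum.elim t u := by ext (i | i) <;> rfl
  have e' (u : β → ℚ) (w : γ → ℚ) : Sum.elim t (Sum.elim u w) ∘ Sum.map id Sum.inr =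
      Sum.elim t w := by ext (i | i) <;> rfl
  rw [Set.mem_inter_iff, hC, hD]
  constructor
  · rintro ⟨⟨u, hu⟩, w, hw⟩
    refine ⟨Sum.elim u w, ?_⟩
    simp only [List.mem_append, List.mem_map]
    rintro _ (⟨c, hc, rfl⟩ | ⟨c, hc, rfl⟩)
    · rw [← Function.comp_assoc, e]
      exact hu c hc
    · rw [← Function.comp_assoc, e']
      exact hw c hc
  · rintro ⟨w, hw⟩
    obtain ⟨u, w, rfl⟩ : ∃ u v, w = Sum.elim u v := ⟨_, _, (Sum.elim_comp_inl_inr w).symm⟩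
    simp only [List.mem_append, List.mem_map] at hw
    refine ⟨⟨u, fun c hc => ?_⟩, w, fun c hc => ?_⟩
    · have := hw _ (Or.inl ⟨c, hc, rfl⟩)
      rwa [← Function.comp_assoc, e] at this
    · have := hw _ (Or.inr ⟨c, hc, rfl⟩)
      rwa [← Function.comp_assoc, e'] at this

theorem biInter {ι : Type*} (I : Finset ι) {S : ι → Set (α → ℚ)} (hS : ∀ i ∈ I, T3Definable (S i)) :
    T3Definable (⋂ i ∈ I, S i) := by
  classical
  induction I using Finset.induction_on with
  | empty => simpa using univ
  | insert i I _ ih =>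
    rw [Finset.set_biInter_insert]
    exact (hS i (by simp)).inter (ih fun j hj => hS j (by simp [hj]))

theorem proj {β : Type} [Finite β] {S : Set (α ⊕ β → ℚ)} (hS : T3Definable S) :
    T3Definable {t : α → ℚ | ∃ w : β → ℚ, Sum.elim t w ∈ S} := by
  obtain ⟨γ, _, C, hC⟩ := hS
  refine ⟨β ⊕ γ, inferInstance, C.map (Equiv.sumAssoc α β γ ∘ ·), fun t => ?_⟩
  have e (u : β → ℚ) (w : γ → ℚ) : Sum.elim t (Sum.elim u w) ∘ Equiv.sumAssoc α β γ =
      Sum.elim (Sum.elim t u) w := by ext ((i | i) | i) <;> rfl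
  simp only [Set.mem_ofPred_eq, hC, List.forall_mem_map, ← Function.comp_assoc]
  constructor
  · rintro ⟨u, w, hw⟩
    exact ⟨Sum.elim u w, by simpa only [e] using hw⟩
  · rintro ⟨w, hw⟩
    obtain ⟨u, w, rfl⟩ : ∃ u v, w = Sum.elim u v := ⟨_, _, (Sum.elim_comp_inl_inr w).symm⟩
    exact ⟨u, w, by simpa only [e] using hw⟩

theorem le (a b : α) : T3Definable {t : α → ℚ | t a ≤ t b} := by
  convert (t3 ![Sum.inl a, Sum.inl b, Sum.inr ()]).proj using 1
  ext t
  simp only [T3, Set.mem_ofPred_eq, Function.comp_apply, Matrix.cons_val, Sum.elim_inl,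
    Sum.elim_inr]
  constructor
  · intro h
    rcases h.eq_or_lt with h | h
    · exact ⟨fun _ => t b + 1, Or.inl ⟨h, by linarith⟩⟩
    · exact ⟨fun _ => t a, Or.inr ⟨rfl, h⟩⟩
  · rintro ⟨w, h | h⟩
    · exact h.1.le
    · exact (h.1.trans_lt h.2).le

theorem exists_le {ι : Type*} (Z : Finset ι) :
    ∀ {α : Type} (y : α) (g : ι → α), T3Definable {t : α → ℚ | ∃ z ∈ Z, t (g z) ≤ t y} := by
  classical
  induction Z using Finset.induction_on with
  | empty =>
    intro α y g
    -- `T3(y, y, y)` is unsatisfiable.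
    convert t3 ![y, y, y] using 1
    ext t
    simp [T3]
  | insert z Z _ ih =>
    intro α y g
    -- An empty `Z` would make the recursive constraint below unsatisfiable, even when it is meant
    -- to be idle.
    rcases Z.eq_empty_or_nonempty with rfl | ⟨x₀, hx₀⟩
    · simpa using le (g z) y
    -- `T3(y, u₁, u₂)` acts as a switch: `y` equals one of `u₁`, `u₂`, and the other may be taken
    -- large enough to make its constraint idle.
    convert ((t3 ![Sum.inl y, Sum.inr 1, Sum.inr 2]).inter
      ((le (Sum.inr 0) (Sum.inr 1)).inter ((le (Sum.inl (g z)) (Sum.inr 2)).inter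
        (ih (Sum.inr (0 : Fin 3)) (Sum.inl ∘ g))))).proj using 1
    ext t
    simp only [T3, Set.mem_ofPred_eq, Set.mem_inter_iff, Function.comp_apply, Matrix.cons_val,
      Sum.elim_inl, Sum.elim_inr, Finset.exists_mem_insert]
    constructor
    · rintro (h | h)
      · refine ⟨![max (t y) (t (g x₀)) + 1, max (t y) (t (g x₀)) + 1, t y], ?_⟩
        simp only [Matrix.cons_val]
        exact ⟨by grind, le_rfl, h, x₀, hx₀, by grind⟩
      · refine ⟨![t y, t y, max (t y) (t (g z)) + 1], ?_⟩
        simp only [Matrix.cons_val]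
        exact ⟨by grind, le_rfl, by grind, h⟩
    · rintro ⟨w, h | h, h₁, h₂, x, hx, h₃⟩
      · exact Or.inr ⟨x, hx, by linarith [h.1]⟩
      · exact Or.inl (by linarith [h.1])

/-- Auxiliary variables are `m` (`none`) and `pₓ` (`some x`), with `T3(m, x, pₓ)`. This forces `m ≤
x` on `X`, and the second conjunct makes `m` the minimum of `X`. Then `pₓ ≤ m` means that `x` is not
minimal, so the last conjunct says that `X` is not constant or some `z ≤ m`; if `X` is constant, `m`
is the value at `y`. -/
theorem clause [Finite α] {y : α} {X : Finset α} (Z : Finset α) (hy : y ∈ X) :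
    T3Definable (clause y X Z) := by
  classical
  have hT (x : α) : T3Definable {t : α ⊕ Option α → ℚ |
      t ∘ ![Sum.inr none, Sum.inl x, Sum.inr (some x)] ∈ T3} := t3 _
  convert ((biInter X fun x _ => hT x).inter
    ((exists_le X (Sum.inr none) (Sum.inl : α → α ⊕ Option α)).inter
      (exists_le (X.map Function.Embedding.some |>.map Function.Embedding.inr |>.disjUnion
        (Z.map Function.Embedding.inl) (by simp [Finset.disjoint_left]))
        (Sum.inr none : α ⊕ Option α) id))).proj using 1
  ext t
  simp only [T3, Set.mem_ofPred_eq, Set.mem_inter_iff, Set.mem_iInter, Function.comp_apply,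
    Matrix.cons_val, Sum.elim_inl, Sum.elim_inr, Temporal.clause, Finset.mem_disjUnion,
    Finset.mem_map, or_and_right, exists_or, id, exists_exists_and_eq_and,
    Function.Embedding.inl_apply, Function.Embedding.inr_apply, Function.Embedding.some_apply]
  constructor
  · intro h
    obtain ⟨x₀, hx₀, hmin⟩ := X.exists_min_image t ⟨y, hy⟩
    refine ⟨fun o => o.elim (t x₀) fun x => if t x = t x₀ then t x₀ + 1 else t x₀, ?_, ?_, ?_⟩
    · intro x hx
      have := hmin x hx
      simp only [Option.elim]
      grind
    · exact ⟨x₀, hx₀, le_rfl⟩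
    · by_cases hX : ∃ x ∈ X, t x ≠ t x₀
      · obtain ⟨x, hx, hne⟩ := hX
        exact Or.inl ⟨x, hx, by simp [hne]⟩
      · push Not at hX
        refine Or.inr ?_
        simp only [Option.elim]
        rw [← hX y hy]
        refine h.resolve_left ?_
        rintro ⟨x, hx, hne⟩
        exact hne ((hX x hx).trans (hX y hy).symm)
  · rintro ⟨w, hT, ⟨x₀, hx₀, hle⟩, h⟩
    by_contra! hcon
    have hw : ∀ x ∈ X, w none = t x := by
      intro x hx
      have h₁ := hT x₀ hx₀
      have h₂ := hcon.1 x₀ hx₀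
      have h₃ := hcon.1 x hx
      grind
    rcases h with ⟨x, hx, h⟩ | ⟨z, hz, h⟩
    · have h₁ := hT x hx
      have h₂ := hw x hx
      grind
    · have h₁ := hcon.2 z hz
      have h₂ := hw y hy
      grind

end T3Definable

/-! ### From constraint systems to primitive positive formulas -/

theorem isConjOfAtomic_foldr_inf {L : Language} {α : Type*} {m : ℕ}
    (l : List (L.BoundedFormula α m)) (hl : ∀ φ ∈ l, φ.IsAtomic) :
    IsConjOfAtomic (l.foldr (· ⊓ ·) ⊤) := by
  induction l with
  | nil => exact .top
  | cons φ l ih =>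
    exact .inf (.atomic (hl φ (by simp))) (ih fun ψ hψ => hl ψ (by simp [hψ]))

theorem IsPrimitivePositive.exs {L : Language} {α : Type*} :
    ∀ {m : ℕ} {φ : L.BoundedFormula α m}, IsPrimitivePositive φ → IsPrimitivePositive φ.exs
  | 0, _, h => h
  | _ + 1, φ, h => IsPrimitivePositive.exs (φ := φ.ex) (.ex h)

theorem T3Definable.ppDefinable {n : ℕ} {R : Set (Fin n → ℚ)} (hR : T3Definable R) :
    PPDefinable t3Lang R := by
  obtain ⟨β, _, C, hC⟩ := hR
  obtain ⟨m, ⟨e⟩⟩ := Finite.exists_equiv_fin β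
  let F (c : Fin 3 → Fin n ⊕ β) : t3Lang.BoundedFormula (Fin n) m :=
    Relations.boundedFormula (L := t3Lang) (n := 3) T3Rel.t3 fun i => .var (Sum.map id e (c i))
  have hF (c) (t : Fin n → ℚ) (w : Fin m → ℚ) :
      (F c).Realize t w ↔ Sum.elim t (w ∘ e) ∘ c ∈ T3 := by
    have : Sum.elim t (w ∘ e) ∘ c = fun i => Sum.elim t w (Sum.map id e (c i)) := by
      ext i
      cases h : c i <;> simp [h]
    rw [this]
    exact Iff.rfl
  refine ⟨BoundedFormula.exs ((C.map F).foldr (· ⊓ ·) ⊤),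
    (IsPrimitivePositive.conj (isConjOfAtomic_foldr_inf _ ?_)).exs, ?_⟩
  · simp only [List.mem_map]
    rintro _ ⟨c, _, rfl⟩
    exact .rel _ _
  · ext t
    rw [hC, Set.mem_ofPred_eq, BoundedFormula.realize_exs]
    simp only [BoundedFormula.realize_foldr_inf, List.forall_mem_map, hF]
    constructor
    · rintro ⟨w, hw⟩
      exact ⟨w ∘ e.symm, by simpa [Function.comp_assoc] using hw⟩
    · rintro ⟨w, hw⟩
      exact ⟨w ∘ e, hw⟩

theorem IsPP.t3Definable {f : (Fin 2 → ℚ) → ℚ} (hf : IsPP f) {n : ℕ}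
    {R : Set (Fin n → ℚ)} (hR : ∀ s t : Fin n → ℚ, SameOrder s t → s ∈ R → t ∈ R)
    (hfR : Preserves f R) (hne : R.Nonempty) : T3Definable R := by
  classical
  let I : Finset (Fin n × Finset (Fin n) × Finset (Fin n)) :=
    Finset.univ.filter fun c => c.1 ∈ c.2.1 ∧ R ⊆ clause c.1 c.2.1 c.2.2
  have hI : R = ⋂ c ∈ I, clause c.1 c.2.1 c.2.2 := by
    refine subset_antisymm (Set.subset_iInter₂ fun c hc => (Finset.mem_filter.1 hc).2.2) ?_
    intro t ht
    by_contra htR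
    obtain ⟨y, X, Z, hy, hRc, htc⟩ := hf.exists_clause hR hfR hne htR
    exact htc (Set.mem_iInter₂.1 ht (y, X, Z) (Finset.mem_filter.2 ⟨Finset.mem_univ _, hy, hRc⟩))
  rw [hI]
  exact T3Definable.biInter I fun c hc => T3Definable.clause _ (Finset.mem_filter.1 hc).2.1

theorem ppDefinable_empty {L : Language} {A : Type*} [L.Structure A] {n : ℕ} :
    PPDefinable L (∅ : Set (Fin n → A)) :=
  ⟨⊥, .conj .bot, by ext t; simp [Formula.Realize]⟩

end Temporal

theorem proposition5p11 (pp : (Fin 2 → ℚ) → ℚ) (hpp : Temporal.IsPP pp)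
    {n : ℕ} (R : Set (Fin n → ℚ)) (hR : Temporal.IsTemporal R) :
    Temporal.PPDefinable Temporal.t3Lang R ↔ Temporal.Preserves pp R := by
  refine ⟨fun h => h.preserves two_ne_zero hpp.preserves_T3, fun h => ?_⟩
  -- For `n = 0` there are no clauses to exclude the empty tuple, so the empty relation is defined
  -- by `⊥`.
  rcases R.eq_empty_or_nonempty with rfl | hne
  · exact Temporal.ppDefinable_empty
  · exact (hpp.t3Definable (fun s t hst => (hR.mem_iff hst).1) h hne).ppDefinable
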